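/- Let $d\ge 1$, let $M_d(\mathbb{R})$ be the space of real $d\times d$ matrices and let $\|\cdot\|$ be the operator norm on it induced by the Euclidean norm on $\mathbb{R}^d$. For a Borel measure $\mu$ on $M_d(\mathbb{R})$ and $n\ge 1$ let $\mu_n$ be the pushforward of the product measure $\mu\times\cdots\times\mu$ ($n$ factors) under $(A_1,\ldots,A_n)\mapsto A_1\cdots A_n$. Use the conventions $\log 0=-\infty$, $e^{-\infty}=0$, $0^0=1$. Theorem (Bochi-type inequality for the norm pressure). Let $\mu$ be a Borel measure on $M_d(\mathbb{R})$ and let $s>0$ be a real number such that $\int\|A\|^s\,d\mu(A)<\infty$. Then the limit $$\mathbf{M}(\mu,s):=\lim_{n\to\infty}\frac1n\log\int\|A_1\cdots A_n\|^s\,d\mu(A_1)\cdots d\mu(A_n)$$ exists in $[-\infty,+\infty)$, and $$\int\|A\|^s\,d\mu_d(A)\le K_{d,s}\,e^{\mathbf{M}(\mu,s)}\left(\int\|A\|^s\,d\mu(A)\right)^{d-1},\qquad K_{d,s}:=d^{\,2+(d+1)s}\max\{d^{1-s},1\}.$$ In particular, $\mathbf{M}(\mu,s)=-\infty$ if and only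 if $\int\|A\|^s\,d\mu_d(A)=0$. -/

import Mathlib

open MeasureTheory Filter Topology
open scoped ENNReal

/-- Real `d × d` matrices carry their Borel `σ`-algebra. -/
instance matMeasurableSpace (d : ℕ) : MeasurableSpace (Matrix (Fin d) (Fin d) ℝ) := borel _

instance matBorelSpace (d : ℕ) : BorelSpace (Matrix (Fin d) (Fin d) ℝ) := ⟨rfl⟩

/-- The operator norm of a real `d × d` matrix induced by the Euclidean norm on `ℝ^d`,
as an extended nonnegative real. -/
noncomputable def matNorm {d : ℕ} (A : Matrix (Fin d) (Fin d) ℝ) : ℝ≥0∞ :=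
  ‖Matrix.toEuclideanCLM (n := Fin d) (𝕜 := ℝ) A‖ₑ

/-- The product `A 0 * A 1 * ⋯ * A (n - 1)`, in this order. -/
def matProd {d n : ℕ} (A : Fin n → Matrix (Fin d) (Fin d) ℝ) : Matrix (Fin d) (Fin d) ℝ :=
  (List.ofFn A).prod

/-- The `n`-fold product measure `μ × ⋯ × μ` on `X ^ n`. It is built by recursion from the binary
product because `MeasureTheory.Measure.pi` is geared to `σ`-finite measures; the two agree there
(`powMeasure_eq_pi`). -/
noncomputable def powMeasure {X : Type*} [MeasurableSpace X] (μ : Measure X) :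
    (n : ℕ) → Measure (Fin n → X)
  | 0 => Measure.dirac Fin.elim0
  | n + 1 => (μ.prod (powMeasure μ n)).map
      (fun p : X × (Fin n → X) => (Fin.cons p.1 p.2 : Fin (n + 1) → X))

/-- On `σ`-finite measures `powMeasure` is Mathlib's product measure. -/
theorem powMeasure_eq_pi {X : Type*} [MeasurableSpace X] (μ : Measure X) [SigmaFinite μ]
    (n : ℕ) : powMeasure μ n = Measure.pi (fun _ : Fin n => μ) := by
  induction n with
  | zero =>
    rw [Measure.pi_of_empty (fun _ : Fin 0 => μ) Fin.elim0]
    rfl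
  | succ n ih =>
    rw [powMeasure, ih]
    have h := (measurePreserving_piFinSuccAbove (fun _ : Fin (n + 1) => μ) 0).symm
    rw [← h.map_eq]
    congr 1
    ext p i
    simp [MeasurableEquiv.piFinSuccAbove, Fin.insertNth_zero', Fin.insertNthEquiv]

/-- The measure `μ_n`: the image of `μ × ⋯ × μ` (`n` factors) under
`(A_1, …, A_n) ↦ A_1 ⋯ A_n`. -/
noncomputable def prodMeasure {d : ℕ} (μ : Measure (Matrix (Fin d) (Fin d) ℝ)) (n : ℕ) :
    Measure (Matrix (Fin d) (Fin d) ℝ) :=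
  (powMeasure μ n).map matProd

/-- The sequence `(1/n) log ∫ ‖A_1 ⋯ A_n‖ ^ s dμ(A_1) ⋯ dμ(A_n)`, with `log 0 = -∞`. -/
noncomputable def pressureSeq {d : ℕ} (μ : Measure (Matrix (Fin d) (Fin d) ℝ)) (s : ℝ)
    (n : ℕ) : EReal :=
  ENNReal.log (∫⁻ A, matNorm (matProd A) ^ s ∂(powMeasure μ n)) / (n : EReal)

/-- The norm pressure `M(μ, s)`, the limit of `pressureSeq μ s`. -/
noncomputable def normPressure {d : ℕ} (μ : Measure (Matrix (Fin d) (Fin d) ℝ)) (s : ℝ) : EReal :=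
  limUnder atTop (pressureSeq μ s)

/-- The constant `K_{d,s}`. -/
noncomputable def bochiConst (d : ℕ) (s : ℝ) : ℝ :=
  (d : ℝ) ^ (2 + ((d : ℝ) + 1) * s) * max ((d : ℝ) ^ (1 - s)) 1

/-! The moments ∫‖A‖^s dμ_n are submultiplicative in n, so Fekete's lemma
(`exists_tendsto_log_div_of_submultiplicative`) gives the limit and identifies it with an infimum.

For the inequality, take a finite r > e^M; some N ≥ 1 has ∫‖A‖^s dμ_N ≤ r^N. The function f(v) =
Σ_{n<N} r^{-n} ∫‖Pv‖^s dμ_n(P) then satisfies ∫ f(Av) dμ(A) ≤ r f(v). In an Auerbach basis V for f,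
every entry of V⁻¹AV has s-th moment at most r (`exists_basis_lintegral_entry_le`).

This bound on one factor suffices because of a deterministic fact (`exists_opNorm_matProd_le`). In
an orthonormal eigenbasis of (V⁻¹)ᵀV⁻¹ with eigenvalues l, the (i, j) entry of A is at most
‖V⁻¹AV‖_F whenever l_j ≤ l_i. An entry of A_1 ⋯ A_d is a sum over index paths with d + 1 vertices,
and l cannot increase strictly along such a path. So some factor is bounded through V, the others by
their own norms. Integrating, summing over the position of that factor and letting r decrease to e^M
gives the claim. -/

namespace Matrix

/-! ### Matrix norms and orthogonal bases adapted to a change of basis. -/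

/-- The operator norm of a real matrix induced by the Euclidean norm. -/
noncomputable def opNorm {d : ℕ} (A : Matrix (Fin d) (Fin d) ℝ) : ℝ :=
  ‖Matrix.toEuclideanCLM (n := Fin d) (𝕜 := ℝ) A‖

/-- The Frobenius norm of a real matrix. -/
noncomputable def frobNorm {d : ℕ} (A : Matrix (Fin d) (Fin d) ℝ) : ℝ :=
  √(∑ i, ∑ j, A i j ^ 2)

variable {d : ℕ}

lemma opNorm_nonneg (A : Matrix (Fin d) (Fin d) ℝ) : 0 ≤ opNorm A := norm_nonneg _

lemma frobNorm_nonneg (A : Matrix (Fin d) (Fin d) ℝ) : 0 ≤ frobNorm A := Real.sqrt_nonneg _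

lemma opNorm_mul_le (A B : Matrix (Fin d) (Fin d) ℝ) : opNorm (A * B) ≤ opNorm A * opNorm B := by
  unfold opNorm; rw [map_mul]; exact norm_mul_le _ _

lemma norm_toLp_mulVec_le_opNorm (A : Matrix (Fin d) (Fin d) ℝ) (v : Fin d → ℝ) :
    ‖WithLp.toLp 2 (A *ᵥ v)‖ ≤ opNorm A * ‖WithLp.toLp 2 v‖ := by
  rw [← toEuclideanCLM_toLp]; exact ContinuousLinearMap.le_opNorm _ _

/-- Cauchy–Schwarz for the Frobenius norm. -/
lemma norm_toLp_mulVec_le_frobNorm (A : Matrix (Fin d) (Fin d) ℝ) (v : Fin d → ℝ) :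
    ‖WithLp.toLp 2 (A *ᵥ v)‖ ≤ frobNorm A * ‖WithLp.toLp 2 v‖ := by
  simp only [EuclideanSpace.norm_eq, Real.norm_eq_abs, sq_abs, frobNorm]
  rw [← Real.sqrt_mul (by positivity), Finset.sum_mul]
  exact Real.sqrt_le_sqrt (Finset.sum_le_sum fun i _ =>
    Finset.sum_mul_sq_le_sq_mul_sq Finset.univ (A i) v)

lemma opNorm_le_frobNorm (A : Matrix (Fin d) (Fin d) ℝ) : opNorm A ≤ frobNorm A := by
  refine ContinuousLinearMap.opNorm_le_bound _ (frobNorm_nonneg A) fun x => ?_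
  exact norm_toLp_mulVec_le_frobNorm A x.ofLp

lemma abs_dotProduct_mulVec_le (A : Matrix (Fin d) (Fin d) ℝ) (x y : Fin d → ℝ) :
    |x ⬝ᵥ A *ᵥ y| ≤ ‖WithLp.toLp 2 x‖ * (frobNorm A * ‖WithLp.toLp 2 y‖) := by
  have h := abs_real_inner_le_norm (WithLp.toLp 2 (A *ᵥ y)) (WithLp.toLp 2 x)
  rw [EuclideanSpace.inner_toLp_toLp] at h
  simp only [star_trivial] at h
  refine h.trans ?_
  rw [mul_comm]
  exact mul_le_mul_of_nonneg_left (norm_toLp_mulVec_le_frobNorm A y) (norm_nonneg _)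

lemma abs_entry_le_opNorm (A : Matrix (Fin d) (Fin d) ℝ) (i j : Fin d) : |A i j| ≤ opNorm A := by
  have h := norm_toLp_mulVec_le_opNorm A (Pi.single j 1)
  have h1 : ‖WithLp.toLp 2 (Pi.single j (1 : ℝ) : Fin d → ℝ)‖ = 1 := by simp
  rw [h1, mul_one, mulVec_single_one] at h
  exact (PiLp.norm_apply_le (WithLp.toLp 2 (A.col j)) i).trans h

lemma frobNorm_le_of_abs_entry_le (A : Matrix (Fin d) (Fin d) ℝ) {c : ℝ} (hc : 0 ≤ c)
    (h : ∀ i j, |A i j| ≤ c) : frobNorm A ≤ d * c := by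
  refine Real.sqrt_le_iff.2 ⟨by positivity, ?_⟩
  calc ∑ i, ∑ j, A i j ^ 2 ≤ ∑ _i : Fin d, ∑ _j : Fin d, c ^ 2 :=
        Finset.sum_le_sum fun i _ => Finset.sum_le_sum fun j _ =>
          sq_le_sq' (abs_le.1 (h i j)).1 (abs_le.1 (h i j)).2
    _ = (d * c) ^ 2 := by simp; ring

lemma opNorm_orthogonal_conj {E : Matrix (Fin d) (Fin d) ℝ} (hE : E ∈ unitaryGroup (Fin d) ℝ)
    (A : Matrix (Fin d) (Fin d) ℝ) : opNorm (star E * A * E) = opNorm A := by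
  have h1 : toEuclideanCLM (n := Fin d) (𝕜 := ℝ) E ∈
      unitary (EuclideanSpace ℝ (Fin d) →L[ℝ] EuclideanSpace ℝ (Fin d)) :=
    Unitary.map_mem _ hE
  unfold opNorm
  rw [map_mul, map_mul, CStarRing.norm_mul_mem_unitary _ h1, map_star,
    CStarRing.norm_mem_unitary_mul _ (Unitary.star_mem h1)]

/-- Every invertible matrix is, up to an orthogonal change of basis on each side, diagonal. This is
the consequence for the entries of `A` in a suitable orthonormal basis. -/
lemma exists_orthogonal_entry_le {V : Matrix (Fin d) (Fin d) ℝ} (hV : IsUnit V.det) :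
    ∃ E ∈ unitaryGroup (Fin d) ℝ, ∃ l : Fin d → ℝ, ∀ i j, l j ≤ l i → ∀ A,
      |(star E * A * E) i j| ≤ frobNorm (V⁻¹ * A * V) := by
  set S := V⁻¹ with hS
  have hSV : V * S = 1 := mul_nonsing_inv V hV
  have hpd : (Sᴴ * S).PosDef := by
    refine PosDef.conjTranspose_mul_self S ?_
    rw [mulVec_injective_iff_isUnit, isUnit_iff_isUnit_det]
    exact isUnit_nonsing_inv_det V hV
  have hH := hpd.isHermitian
  set E : Matrix (Fin d) (Fin d) ℝ := hH.eigenvectorUnitary.1 with hE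
  have hEu : E ∈ unitaryGroup (Fin d) ℝ := hH.eigenvectorUnitary.2
  have hEE : star E * E = 1 := (mem_unitaryGroup_iff').1 hEu
  have hEE' : E * star E = 1 := (mem_unitaryGroup_iff).1 hEu
  have hspec : star E * (Sᴴ * S) * E = diagonal hH.eigenvalues := by
    have := hH.conjStarAlgAut_star_eigenvectorUnitary
    rw [Unitary.conjStarAlgAut_apply, Unitary.coe_star, star_star] at this
    exact this
  refine ⟨E, hEu, hH.eigenvalues, fun i j hij A => ?_⟩
  set l := hH.eigenvalues with hl
  have hpos : ∀ i, 0 < l i := hpd.eigenvalues_pos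
  -- The columns of T are orthogonal, with squared lengths l i.
  set T := S * E with hT
  have hTT : Tᵀ * T = diagonal l := by
    rw [← hspec, hT, transpose_mul, star_eq_conjTranspose]
    simp [Matrix.mul_assoc]
  have hnorm : ∀ i, ‖WithLp.toLp 2 (T.col i)‖ = √(l i) := by
    intro i
    rw [EuclideanSpace.norm_eq]
    congr 1
    have := congrFun (congrFun hTT i) i
    rw [diagonal_apply_eq, mul_apply] at this
    rw [← this]
    refine Finset.sum_congr rfl fun k _ => ?_
    simp [sq]
  -- Pairing columns i and j of T through S A V gives l i times the entry sought. Cauchy–Schwarz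
  -- bounds that pairing by √(l i) √(l j) times the Frobenius norm, and l j ≤ l i finishes.
  have hmain : Tᵀ * ((S * A * V) * T) = diagonal l * (star E * A * E) := by
    calc Tᵀ * ((S * A * V) * T) = star E * (Sᴴ * S) * (E * star E) * A * (V * S) * E := by
          rw [hEE', hT, transpose_mul, star_eq_conjTranspose]
          simp [Matrix.mul_assoc]
      _ = (star E * (Sᴴ * S) * E) * (star E * A * E) := by
          rw [hSV]; simp only [Matrix.mul_assoc, Matrix.one_mul]
      _ = _ := by rw [hspec]
  have hent := congrFun (congrFun hmain i) j
  rw [diagonal_mul] at hent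
  have hdot : (Tᵀ * ((S * A * V) * T)) i j = T.col i ⬝ᵥ (S * A * V) *ᵥ T.col j := rfl
  have hb := abs_dotProduct_mulVec_le (S * A * V) (T.col i) (T.col j)
  rw [← hdot, hent, hnorm, hnorm, abs_mul, abs_of_pos (hpos i)] at hb
  have hF := frobNorm_nonneg (S * A * V)
  have h2 : √(l i) * (frobNorm (S * A * V) * √(l j)) ≤ l i * frobNorm (S * A * V) := by
    calc _ ≤ √(l i) * (frobNorm (S * A * V) * √(l i)) := by gcongr
      _ = (√(l i) * √(l i)) * frobNorm (S * A * V) := by ring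
      _ = _ := by rw [Real.mul_self_sqrt (hpos i).le]
  exact le_of_mul_le_mul_left (hb.trans h2) (hpos i)

end Matrix

/-! ### Matrix products as sums over index paths. -/

lemma matProd_succ {d n : ℕ} (A : Fin (n + 1) → Matrix (Fin d) (Fin d) ℝ) :
    matProd A = A 0 * matProd (Fin.tail A) := by
  simp only [matProd, List.ofFn_succ, List.prod_cons]
  rfl

lemma matProd_conj {d n : ℕ} {E E' : Matrix (Fin d) (Fin d) ℝ} (h : E * E' = 1) (h' : E' * E = 1)
    (A : Fin n → Matrix (Fin d) (Fin d) ℝ) :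
    matProd (fun k => E' * A k * E) = E' * matProd A * E := by
  induction n with
  | zero => simp [matProd, h']
  | succ n ih =>
    rw [matProd_succ, matProd_succ]
    have := ih (Fin.tail A)
    change E' * A 0 * E * matProd (fun k => E' * Fin.tail A k * E) = _
    rw [this]
    calc E' * A 0 * E * (E' * matProd (Fin.tail A) * E)
        = E' * A 0 * (E * E') * matProd (Fin.tail A) * E := by simp only [Matrix.mul_assoc]
      _ = _ := by rw [h]; simp only [Matrix.mul_assoc, Matrix.one_mul]

/-- An entry of a product of matrices is controlled by the largest product along a path. -/
lemma exists_path_abs_matProd_le {d : ℕ} (n : ℕ) (B : Fin (n + 1) → Matrix (Fin d) (Fin d) ℝ)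
    (i j : Fin d) : ∃ p : Fin (n + 2) → Fin d, p 0 = i ∧
      |matProd B i j| ≤ (d : ℝ) ^ n * ∏ k : Fin (n + 1), |B k (p k.castSucc) (p k.succ)| := by
  induction n generalizing i with
  | zero =>
    refine ⟨![i, j], rfl, ?_⟩
    simp [matProd]
  | succ n ih =>
    obtain ⟨k, -, hk⟩ := Finset.exists_max_image Finset.univ
      (fun k => |B 0 i k * matProd (Fin.tail B) k j|) ⟨i, Finset.mem_univ _⟩
    obtain ⟨p, hp0, hp⟩ := ih (Fin.tail B) k
    refine ⟨Fin.cons i p, rfl, ?_⟩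
    rw [matProd_succ, Matrix.mul_apply, Fin.prod_univ_succ]
    -- Bounding a sum by d times its largest term costs one factor d per interior vertex of the
    -- path.
    have h1 : |∑ k, B 0 i k * matProd (Fin.tail B) k j| ≤
        d * |B 0 i k * matProd (Fin.tail B) k j| := by
      refine (Finset.abs_sum_le_sum_abs _ _).trans ((Finset.sum_le_card_nsmul _ _ _ hk).trans ?_)
      simp
    refine h1.trans ?_
    rw [abs_mul]
    simp only [Fin.castSucc_zero, Fin.cons_zero, Fin.cons_succ, ← Fin.succ_castSucc, hp0]
    calc (d : ℝ) * (|B 0 i k| * |matProd (Fin.tail B) k j|)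
        ≤ d * (|B 0 i k| * ((d : ℝ) ^ n *
          ∏ k : Fin (n + 1), |Fin.tail B k (p k.castSucc) (p k.succ)|)) := by gcongr
      _ = _ := by rw [pow_succ]; simp only [Fin.tail]; ring

/-- A map from `d + 1` steps to `d` heights cannot be strictly increasing. -/
lemma exists_step_le {d n : ℕ} (h : d < n + 1) (l : Fin d → ℝ) (p : Fin (n + 1) → Fin d) :
    ∃ k : Fin n, l (p k.succ) ≤ l (p k.castSucc) := by
  by_contra! hc
  have hm : StrictMono (l ∘ p) := Fin.strictMono_iff_lt_succ.2 hc
  have hinj : Function.Injective p := hm.injective.of_comp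
  have := Fintype.card_le_of_injective p hinj
  simp at this
  omega

/-- The inequality behind Bochi's theorem: a product of `d` matrices is controlled by one of
the factors in an arbitrary basis and the remaining ones in the standard basis. -/
lemma exists_opNorm_matProd_le {d : ℕ} (hd : 1 ≤ d) {V : Matrix (Fin d) (Fin d) ℝ}
    (hV : IsUnit V.det) (A : Fin d → Matrix (Fin d) (Fin d) ℝ) :
    ∃ k, (matProd A).opNorm ≤ (d : ℝ) ^ d * ((V⁻¹ * A k * V).frobNorm *
      ∏ m ∈ Finset.univ.erase k, (A m).opNorm) := by
  obtain ⟨E, hE, l, hl⟩ := Matrix.exists_orthogonal_entry_le hV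
  obtain ⟨n, rfl⟩ : ∃ n, d = n + 1 := ⟨d - 1, by omega⟩
  -- Orthogonal conjugation preserves operator norms, so entries of `B m` are still bounded by the
  -- norm of `A m`.
  set B := fun k => star E * A k * E with hB
  have hBA : ∀ k, (B k).opNorm = (A k).opNorm := fun k => Matrix.opNorm_orthogonal_conj hE _
  have hprod : (matProd A).opNorm = (matProd B).opNorm := by
    rw [hB, matProd_conj (Matrix.mem_unitaryGroup_iff.1 hE) (Matrix.mem_unitaryGroup_iff'.1 hE),
      Matrix.opNorm_orthogonal_conj hE]
  obtain ⟨⟨i, j⟩, -, hij⟩ := Finset.exists_max_image (Finset.univ : Finset (Fin (n+1) × Fin (n+1)))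
    (fun q => |matProd B q.1 q.2|) ⟨(0, 0), Finset.mem_univ _⟩
  obtain ⟨p, -, hp⟩ := exists_path_abs_matProd_le n B i j
  obtain ⟨k, hk⟩ := exists_step_le (by omega) l p
  refine ⟨k, ?_⟩
  rw [hprod]
  -- One factor d comes from the Frobenius norm and d - 1 from the interior vertices of the path,
  -- whence d ^ d.
  calc (matProd B).opNorm ≤ (n + 1 : ℕ) * |matProd B i j| :=
        (Matrix.opNorm_le_frobNorm _).trans (Matrix.frobNorm_le_of_abs_entry_le _ (abs_nonneg _)
          fun i' j' => hij (i', j') (Finset.mem_univ _))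
    _ ≤ (n + 1 : ℕ) * (((n + 1 : ℕ) : ℝ) ^ n *
          ∏ k : Fin (n + 1), |B k (p k.castSucc) (p k.succ)|) := by gcongr
    _ = ((n + 1 : ℕ) : ℝ) ^ (n + 1) * (|B k (p k.castSucc) (p k.succ)| *
          ∏ m ∈ Finset.univ.erase k, |B m (p m.castSucc) (p m.succ)|) := by
        rw [Finset.mul_prod_erase Finset.univ (fun m => |B m (p m.castSucc) (p m.succ)|)
          (Finset.mem_univ k), pow_succ]
        ring
    _ ≤ _ := by
        have h1 := hl _ _ hk (A k)
        have h2 : ∏ m ∈ Finset.univ.erase k, |B m (p m.castSucc) (p m.succ)| ≤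
            ∏ m ∈ Finset.univ.erase k, (A m).opNorm :=
          Finset.prod_le_prod (fun _ _ => abs_nonneg _) fun m _ =>
            (Matrix.abs_entry_le_opNorm _ _ _).trans (hBA m).le
        have h3 := (V⁻¹ * A k * V).frobNorm_nonneg
        gcongr

/-! ### Product measures and independence. -/

section PowMeasure

variable {X : Type*} [MeasurableSpace X]

lemma measurable_finCons (n : ℕ) :
    Measurable (fun p : X × (Fin n → X) => (Fin.cons p.1 p.2 : Fin (n + 1) → X)) := by
  refine measurable_pi_iff.2 fun i => ?_
  refine Fin.cases ?_ (fun j => ?_) i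
  · simpa using measurable_fst
  · simpa [Function.comp_def] using (measurable_pi_apply j).comp measurable_snd

instance powMeasure.instSFinite (μ : Measure X) [SFinite μ] (n : ℕ) : SFinite (powMeasure μ n) := by
  induction n with
  | zero => rw [powMeasure]; infer_instance
  | succ n ih => rw [powMeasure]; infer_instance

lemma lintegral_powMeasure_prod (μ : Measure X) [SFinite μ] {n : ℕ} (g : Fin n → X → ℝ≥0∞)
    (hg : ∀ k, Measurable (g k)) :
    ∫⁻ A, ∏ k, g k (A k) ∂(powMeasure μ n) = ∏ k, ∫⁻ x, g k x ∂μ := by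
  induction n with
  | zero => simp [powMeasure]
  | succ n ih =>
    have hm : Measurable fun A : Fin (n + 1) → X => ∏ k, g k (A k) :=
      Finset.measurable_prod _ fun k _ => (hg k).comp (measurable_pi_apply k)
    have hm' : Measurable fun A : Fin n → X => ∏ k, g k.succ (A k) :=
      Finset.measurable_prod _ fun k _ => (hg k.succ).comp (measurable_pi_apply k)
    rw [powMeasure, lintegral_map hm (measurable_finCons n), Fin.prod_univ_succ]
    simp only [Fin.prod_univ_succ, Fin.cons_zero, Fin.cons_succ]
    rw [lintegral_prod_mul (hg 0).aemeasurable hm'.aemeasurable,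
      ih (fun k => g k.succ) fun k => hg k.succ]

end PowMeasure

/-! ### Laws of random products and their moments. -/

section Matrices

variable {d : ℕ}

instance : SecondCountableTopology (Matrix (Fin d) (Fin d) ℝ) :=
  inferInstanceAs (SecondCountableTopology (Fin d → Fin d → ℝ))

lemma measurable_matProd (n : ℕ) :
    Measurable (matProd : (Fin n → Matrix (Fin d) (Fin d) ℝ) → Matrix (Fin d) (Fin d) ℝ) := by
  induction n with
  | zero => exact measurable_const
  | succ n ih =>
    have : (matProd : (Fin (n + 1) → Matrix (Fin d) (Fin d) ℝ) → _) =
        fun A => A 0 * matProd (Fin.tail A) := funext matProd_succ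
    rw [this]
    refine (measurable_pi_apply 0).mul (ih.comp ?_)
    exact measurable_pi_iff.2 fun i => measurable_pi_apply i.succ

lemma matNorm_eq (A : Matrix (Fin d) (Fin d) ℝ) : matNorm A = ENNReal.ofReal A.opNorm :=
  (ofReal_norm _).symm

lemma Matrix.continuous_opNorm :
    Continuous (Matrix.opNorm : Matrix (Fin d) (Fin d) ℝ → ℝ) :=
  continuous_norm.comp (LinearMap.continuous_of_finiteDimensional
    (Matrix.toEuclideanCLM (n := Fin d) (𝕜 := ℝ)).toAlgEquiv.toLinearMap)

lemma continuous_matNorm : Continuous (matNorm : Matrix (Fin d) (Fin d) ℝ → ℝ≥0∞) := by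
  simp_rw [funext matNorm_eq]
  exact ENNReal.continuous_ofReal.comp Matrix.continuous_opNorm

lemma measurable_matNorm_rpow (s : ℝ) :
    Measurable fun A : Matrix (Fin d) (Fin d) ℝ => matNorm A ^ s :=
  continuous_matNorm.measurable.pow_const s

lemma matNorm_mul_le (A B : Matrix (Fin d) (Fin d) ℝ) : matNorm (A * B) ≤ matNorm A * matNorm B := by
  simp_rw [matNorm_eq]
  rw [← ENNReal.ofReal_mul A.opNorm_nonneg]
  exact ENNReal.ofReal_le_ofReal (Matrix.opNorm_mul_le A B)

lemma matNorm_eq_zero {A : Matrix (Fin d) (Fin d) ℝ} : matNorm A = 0 ↔ A = 0 := by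
  rw [matNorm, ← ofReal_norm, ENNReal.ofReal_eq_zero, norm_le_zero_iff,
    EmbeddingLike.map_eq_zero_iff]

lemma matNorm_ne_top (A : Matrix (Fin d) (Fin d) ℝ) : matNorm A ≠ ∞ := enorm_ne_top

lemma enorm_toLp_mulVec_le (A : Matrix (Fin d) (Fin d) ℝ) (v : Fin d → ℝ) :
    ‖WithLp.toLp 2 (A.mulVec v)‖ₑ ≤ matNorm A * ‖WithLp.toLp 2 v‖ₑ := by
  rw [matNorm_eq, ← ofReal_norm, ← ofReal_norm,
    ← ENNReal.ofReal_mul A.opNorm_nonneg]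
  exact ENNReal.ofReal_le_ofReal (Matrix.norm_toLp_mulVec_le_opNorm A v)

variable {μ : Measure (Matrix (Fin d) (Fin d) ℝ)} {s : ℝ}

/-- A measure with a finite moment is `s`-finite: away from the zero matrix it is `σ`-finite, and
the zero matrix is an atom. -/
lemma sFinite_of_lintegral_matNorm_rpow (hs : 0 < s) (hμ : ∫⁻ A, matNorm A ^ s ∂μ < ∞) :
    SFinite μ := by
  have hfin : IsFiniteMeasure (μ.withDensity fun A => matNorm A ^ s) :=
    isFiniteMeasure_withDensity hμ.ne
  refine sFinite_of_absolutelyContinuous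
    (ν := Measure.dirac 0 + μ.withDensity fun A => matNorm A ^ s) ?_
  refine Measure.AbsolutelyContinuous.mk fun t ht h => ?_
  rw [Measure.add_apply, add_eq_zero, Measure.dirac_apply' _ ht,
    withDensity_apply_eq_zero (measurable_matNorm_rpow s)] at h
  have h0 : (0 : Matrix (Fin d) (Fin d) ℝ) ∉ t := by
    intro h0; simp [h0] at h
  refine measure_mono_null ?_ h.2
  refine fun A hA => ⟨?_, hA⟩
  simp only [Set.mem_ofPred_eq, ne_eq, ENNReal.rpow_eq_zero_iff_of_pos hs, matNorm_eq_zero]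
  rintro rfl
  exact h0 hA

instance prodMeasure.instSFinite [SFinite μ] (n : ℕ) : SFinite (prodMeasure μ n) := by
  unfold prodMeasure; infer_instance

lemma prodMeasure_zero : prodMeasure μ 0 = Measure.dirac 1 := by
  rw [prodMeasure, powMeasure, Measure.map_dirac' (measurable_matProd 0)]
  rfl

/-- Makes μ_n a convolution power, so that associativity allows splitting a product anywhere. -/
lemma prodMeasure_succ [SFinite μ] (n : ℕ) : prodMeasure μ (n + 1) = μ ∗ₘ prodMeasure μ n := by
  rw [prodMeasure, powMeasure, Measure.map_map (measurable_matProd _) (measurable_finCons n),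
    Measure.mconv, prodMeasure]
  have h := Measure.map_prod_map μ (powMeasure μ n) measurable_id (measurable_matProd (d := d) n)
  rw [Measure.map_id] at h
  rw [h,
    Measure.map_map measurable_mul (measurable_id.prodMap (measurable_matProd n))]
  congr 1
  funext p
  simp [matProd_succ]

lemma prodMeasure_one [SFinite μ] : prodMeasure μ 1 = μ := by
  rw [prodMeasure_succ, prodMeasure_zero, Measure.mconv_dirac_one]

lemma prodMeasure_add [SFinite μ] (m n : ℕ) :
    prodMeasure μ (m + n) = prodMeasure μ m ∗ₘ prodMeasure μ n := by
  induction m with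
  | zero => rw [zero_add, prodMeasure_zero, Measure.dirac_one_mconv]
  | succ m ih =>
    rw [Nat.add_right_comm, prodMeasure_succ, ih, prodMeasure_succ,
      Measure.mconv_assoc]

lemma prodMeasure_succ' [SFinite μ] (n : ℕ) : prodMeasure μ (n + 1) = prodMeasure μ n ∗ₘ μ := by
  rw [prodMeasure_add, prodMeasure_one]

/-- The `s`-th moment of the norm of a product of `n` matrices. -/
noncomputable def normMoment (μ : Measure (Matrix (Fin d) (Fin d) ℝ)) (s : ℝ) (n : ℕ) : ℝ≥0∞ :=
  ∫⁻ A, matNorm A ^ s ∂(prodMeasure μ n)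

lemma pressureSeq_eq (n : ℕ) :
    pressureSeq μ s n = ENNReal.log (normMoment μ s n) / (n : EReal) := by
  rw [pressureSeq, normMoment, prodMeasure,
    lintegral_map (measurable_matNorm_rpow s) (measurable_matProd n)]

lemma normMoment_one [SFinite μ] : normMoment μ s 1 = ∫⁻ A, matNorm A ^ s ∂μ := by
  rw [normMoment, prodMeasure_one]

lemma normMoment_add_le [SFinite μ] (hs : 0 < s) (m n : ℕ) :
    normMoment μ s (m + n) ≤ normMoment μ s m * normMoment μ s n := by
  rw [normMoment, prodMeasure_add, Measure.lintegral_mconv_eq_lintegral_prod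
    (measurable_matNorm_rpow s), normMoment, normMoment, ← lintegral_prod_mul
    (measurable_matNorm_rpow s).aemeasurable (measurable_matNorm_rpow s).aemeasurable]
  refine lintegral_mono fun p => ?_
  rw [← ENNReal.mul_rpow_of_nonneg _ _ hs.le]
  exact ENNReal.rpow_le_rpow (matNorm_mul_le _ _) hs.le

lemma normMoment_lt_top [SFinite μ] (hs : 0 < s) (hμ : ∫⁻ A, matNorm A ^ s ∂μ < ∞) (n : ℕ) :
    normMoment μ s n < ∞ := by
  induction n with
  | zero =>
    rw [normMoment, prodMeasure_zero, lintegral_dirac' _ (measurable_matNorm_rpow s)]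
    exact ENNReal.rpow_lt_top_of_nonneg hs.le (matNorm_ne_top _)
  | succ n ih =>
    refine (normMoment_add_le hs n 1).trans_lt (ENNReal.mul_lt_top ih ?_)
    rwa [normMoment_one]

end Matrices

/-! ### Auerbach bases by maximizing the determinant. -/

/-- An Auerbach basis (the columns of `V`) for a positive, continuous, `s`-homogeneous function. No
convexity is needed. -/
theorem exists_auerbach_basis {d : ℕ} {s : ℝ} (hs : 0 < s) (f : (Fin d → ℝ) → ℝ≥0∞)
    (hcont : Continuous f) (hhom : ∀ (c : ℝ) v, f (c • v) = ‖c‖ₑ ^ s * f v)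
    (hfin : ∀ v, f v ≠ ∞) (hlow : ∀ v i, ‖v i‖ₑ ^ s ≤ f v) :
    ∃ V : Matrix (Fin d) (Fin d) ℝ, IsUnit V.det ∧ (∀ j, f (V.col j) ≤ 1) ∧
      ∀ w i, ‖(V⁻¹.mulVec w) i‖ₑ ^ s ≤ f w := by
  have hscale : ∀ v, f v ≠ 0 → ∃ c : ℝ, c ≠ 0 ∧ f (c • v) = 1 ∧ ‖c‖ₑ ^ s = (f v)⁻¹ := by
    intro v hv
    have hpos : 0 < (f v).toReal := ENNReal.toReal_pos hv (hfin v)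
    have hc : 0 < (f v).toReal ^ (-s⁻¹) := Real.rpow_pos_of_pos hpos _
    have hcs : ‖(f v).toReal ^ (-s⁻¹)‖ₑ ^ s = (f v)⁻¹ := by
      rw [Real.enorm_eq_ofReal hc.le, ENNReal.ofReal_rpow_of_pos hc, ← Real.rpow_mul hpos.le,
        neg_mul, inv_mul_cancel₀ hs.ne', Real.rpow_neg_one, ENNReal.ofReal_inv_of_pos hpos,
        ENNReal.ofReal_toReal (hfin v)]
    refine ⟨_, hc.ne', ?_, hcs⟩
    rw [hhom, hcs, ENNReal.inv_mul_cancel hv (hfin v)]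
  have hzero : ∀ v, f v = 0 → v = 0 := by
    intro v hv
    funext i
    have := hlow v i
    rw [hv, nonpos_iff_eq_zero, ENNReal.rpow_eq_zero_iff_of_pos hs, enorm_eq_zero] at this
    exact this
  let K : Set (Matrix (Fin d) (Fin d) ℝ) := {V | ∀ j, f (V.col j) ≤ 1}
  have hcol : ∀ j, Continuous fun V : Matrix (Fin d) (Fin d) ℝ => f (V.col j) := fun j =>
    hcont.comp (continuous_pi fun i => continuous_id.matrix_elem i j)
  have hKclosed : IsClosed K := by
    have : K = ⋂ j, {V | f (V.col j) ≤ 1} := by ext V; simp [K]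
    rw [this]
    exact isClosed_iInter fun j => isClosed_le (hcol j) continuous_const
  -- The lower bound `hlow` confines all entries to [-1, 1].
  have hKcompact : IsCompact K := by
    have hbox : IsCompact (Set.univ.pi fun _ : Fin d => Set.univ.pi fun _ : Fin d =>
        Set.Icc (-1 : ℝ) 1) :=
      isCompact_univ_pi fun _ => isCompact_univ_pi fun _ => isCompact_Icc
    refine IsCompact.of_isClosed_subset (X := Matrix (Fin d) (Fin d) ℝ) hbox hKclosed ?_
    intro V hV i _ j _
    have h1 := (hlow (V.col j) i).trans (hV j)
    rw [← ENNReal.one_rpow s, ENNReal.rpow_le_rpow_iff hs] at h1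
    rw [Set.mem_Icc, ← abs_le, ← Real.norm_eq_abs]
    simpa [enorm_le_iff_norm_le, ← ofReal_norm] using h1
  -- A nonsingular competitor, a rescaled standard basis, makes the maximal determinant nonzero.
  obtain ⟨U, hUK, hU⟩ : ∃ U ∈ K, U.det ≠ 0 := by
    have hne : ∀ j : Fin d, f (Pi.single j 1) ≠ 0 := fun j h => by
      have := congrFun (hzero _ h) j
      simp at this
    choose c hc0 hc1 _ using fun j => hscale _ (hne j)
    refine ⟨Matrix.diagonal c, fun j => ?_, ?_⟩
    · have : (Matrix.diagonal c).col j = c j • Pi.single j 1 := by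
        funext i
        by_cases h : i = j
        · subst h; simp
        · simp [h]
      rw [this, hc1]
    · rw [Matrix.det_diagonal]
      exact Finset.prod_ne_zero_iff.2 fun j _ => hc0 j
  obtain ⟨V, hVK, hV⟩ := hKcompact.exists_isMaxOn ⟨U, hUK⟩
    (f := fun W : Matrix (Fin d) (Fin d) ℝ => |W.det|)
    (Continuous.matrix_det continuous_id).abs.continuousOn
  have hdet : 0 < |V.det| := (abs_pos.2 hU).trans_le (hV hUK)
  have hVdet : IsUnit V.det := isUnit_iff_ne_zero.2 (abs_pos.1 hdet)
  refine ⟨V, hVdet, hVK, ?_⟩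
  -- By Cramer's rule, replacing column i of V by w multiplies the determinant by the i-th
  -- coordinate of w in the basis V; maximality bounds that coordinate by 1.
  have hball : ∀ w, f w ≤ 1 → ∀ i, ‖(V⁻¹.mulVec w) i‖ₑ ≤ 1 := by
    intro w hw i
    have hmem : V.updateCol i w ∈ K := by
      intro j
      by_cases h : j = i
      · subst h
        have : (V.updateCol j w).col j = w := by funext k; simp
        rwa [this]
      · have : (V.updateCol i w).col j = V.col j := by funext k; simp [h]
        rw [this]; exact hVK j
    have h1 : |(V.updateCol i w).det| ≤ |V.det| := hV hmem
    have h2 : (V.updateCol i w).det = V.det * (V⁻¹.mulVec w) i := by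
      rw [← Matrix.cramer_apply, Matrix.cramer_eq_adjugate_mulVec, Matrix.inv_def,
        Matrix.smul_mulVec, Pi.smul_apply, smul_eq_mul, ← mul_assoc,
        Ring.mul_inverse_cancel _ hVdet, one_mul]
    rw [h2, abs_mul] at h1
    have h3 : ‖(V⁻¹.mulVec w) i‖ ≤ 1 := le_of_mul_le_mul_left (by simpa using h1) hdet
    simpa [← ofReal_norm] using h3
  intro w i
  by_cases hw : f w = 0
  · rw [hzero w hw, Matrix.mulVec_zero]
    simp [ENNReal.zero_rpow_of_pos hs]
  · obtain ⟨c, -, hc1, hcs⟩ := hscale w hw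
    have h := ENNReal.rpow_le_rpow (hball _ hc1.le i) hs.le
    rw [Matrix.mulVec_smul, Pi.smul_apply, smul_eq_mul, enorm_mul, ENNReal.one_rpow,
      ENNReal.mul_rpow_of_nonneg _ _ hs.le, hcs, mul_comm, ← div_eq_mul_inv] at h
    simpa using (ENNReal.div_le_iff hw (hfin w)).1 h

/-! ### Moments along orbits of vectors and the adapted basis. -/

section OrbitMoment

variable {d : ℕ} {μ : Measure (Matrix (Fin d) (Fin d) ℝ)} {s : ℝ}

/-- The `s`-th moment of the image of the vector `v` under a product of `n` matrices. -/
noncomputable def orbitMoment (μ : Measure (Matrix (Fin d) (Fin d) ℝ)) (s : ℝ) (n : ℕ)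
    (v : Fin d → ℝ) : ℝ≥0∞ :=
  ∫⁻ P, ‖WithLp.toLp 2 (P.mulVec v)‖ₑ ^ s ∂(prodMeasure μ n)

lemma continuous_enorm_toLp : Continuous fun v : Fin d → ℝ => ‖WithLp.toLp 2 v‖ₑ :=
  continuous_enorm.comp (PiLp.continuous_toLp 2 _)

lemma measurable_enorm_mulVec_rpow (s : ℝ) (v : Fin d → ℝ) :
    Measurable fun P : Matrix (Fin d) (Fin d) ℝ => ‖WithLp.toLp 2 (P.mulVec v)‖ₑ ^ s :=
  (continuous_enorm_toLp.comp
    (continuous_id.matrix_mulVec continuous_const)).measurable.pow_const s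

lemma enorm_mulVec_rpow_le (hs : 0 < s) (P : Matrix (Fin d) (Fin d) ℝ) (v : Fin d → ℝ) :
    ‖WithLp.toLp 2 (P.mulVec v)‖ₑ ^ s ≤ matNorm P ^ s * ‖WithLp.toLp 2 v‖ₑ ^ s := by
  rw [← ENNReal.mul_rpow_of_nonneg _ _ hs.le]
  exact ENNReal.rpow_le_rpow (enorm_toLp_mulVec_le P v) hs.le

lemma orbitMoment_zero (v : Fin d → ℝ) : orbitMoment μ s 0 v = ‖WithLp.toLp 2 v‖ₑ ^ s := by
  rw [orbitMoment, prodMeasure_zero, lintegral_dirac' _ (measurable_enorm_mulVec_rpow s v),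
    Matrix.one_mulVec]

lemma orbitMoment_le (hs : 0 < s) (n : ℕ) (v : Fin d → ℝ) :
    orbitMoment μ s n v ≤ normMoment μ s n * ‖WithLp.toLp 2 v‖ₑ ^ s := by
  rw [normMoment, ← lintegral_mul_const _ (measurable_matNorm_rpow s)]
  exact lintegral_mono fun P => enorm_mulVec_rpow_le hs P v

lemma orbitMoment_smul (hs : 0 < s) (n : ℕ) (c : ℝ) (v : Fin d → ℝ) :
    orbitMoment μ s n (c • v) = ‖c‖ₑ ^ s * orbitMoment μ s n v := by
  rw [orbitMoment, orbitMoment, ← lintegral_const_mul _ (measurable_enorm_mulVec_rpow s v)]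
  refine lintegral_congr fun P => ?_
  rw [Matrix.mulVec_smul, WithLp.toLp_smul, enorm_smul, ENNReal.mul_rpow_of_nonneg _ _ hs.le]

lemma orbitMoment_ne_top [SFinite μ] (hs : 0 < s) (hμ : ∫⁻ A, matNorm A ^ s ∂μ < ∞) (n : ℕ)
    (v : Fin d → ℝ) : orbitMoment μ s n v ≠ ∞ :=
  ((orbitMoment_le hs n v).trans_lt (ENNReal.mul_lt_top (normMoment_lt_top hs hμ n)
    (ENNReal.rpow_lt_top_of_nonneg hs.le enorm_ne_top))).ne

/-- Dominated convergence: near v the integrand is at most ‖P‖^s C^s for any C > ‖v‖. -/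
lemma continuous_orbitMoment [SFinite μ] (hs : 0 < s) (hμ : ∫⁻ A, matNorm A ^ s ∂μ < ∞) (n : ℕ) :
    Continuous (orbitMoment μ s n) := by
  refine continuous_iff_continuousAt.2 fun v => ?_
  obtain ⟨C, hC⟩ := exists_between (enorm_lt_top (x := WithLp.toLp 2 v))
  refine tendsto_lintegral_filter_of_dominated_convergence (fun P => matNorm P ^ s * C ^ s)
    (Eventually.of_forall fun w => measurable_enorm_mulVec_rpow s w) ?_ ?_ ?_
  · filter_upwards [continuous_enorm_toLp.continuousAt.eventually_lt_const hC.1] with w hw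
    refine Eventually.of_forall fun P => (enorm_mulVec_rpow_le hs P w).trans ?_
    gcongr
  · rw [lintegral_mul_const _ (measurable_matNorm_rpow s)]
    exact (ENNReal.mul_lt_top (normMoment_lt_top hs hμ n)
      (ENNReal.rpow_lt_top_of_nonneg hs.le hC.2.ne)).ne
  · refine Eventually.of_forall fun P => ?_
    exact ((ENNReal.continuous_rpow_const.comp continuous_enorm_toLp).comp
      (continuous_const.matrix_mulVec continuous_id)).tendsto v

/-- The last factor of the product acts first on v, hence the splitting on the right by
`prodMeasure_succ'`. -/
lemma lintegral_orbitMoment_mulVec [SFinite μ] (n : ℕ) (v : Fin d → ℝ) :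
    ∫⁻ A, orbitMoment μ s n (A.mulVec v) ∂μ = orbitMoment μ s (n + 1) v := by
  have hm := measurable_enorm_mulVec_rpow (d := d) s v
  rw [orbitMoment, prodMeasure_succ', Measure.lintegral_mconv_eq_lintegral_prod hm]
  refine ((lintegral_prod_symm' _ (hm.comp measurable_mul)).trans ?_).symm
  refine lintegral_congr fun A => ?_
  simp only [orbitMoment, Function.comp_apply, Matrix.mulVec_mulVec]

/-- If some moment satisfies `normMoment μ s N ≤ r ^ N`, then in a suitable basis all entries have
`s`-th moment at most `r`. -/
theorem exists_basis_lintegral_entry_le [SFinite μ] (hs : 0 < s)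
    (hμ : ∫⁻ A, matNorm A ^ s ∂μ < ∞) {r : ℝ≥0∞} (hr0 : r ≠ 0) (hr : r ≠ ∞) {N : ℕ} (hN : N ≠ 0)
    (hNr : normMoment μ s N ≤ r ^ N) :
    ∃ V : Matrix (Fin d) (Fin d) ℝ, IsUnit V.det ∧
      ∀ i j, ∫⁻ A, ‖(V⁻¹ * A * V) i j‖ₑ ^ s ∂μ ≤ r := by
  set h : (Fin d → ℝ) → ℕ → ℝ≥0∞ := fun v n => r⁻¹ ^ n * orbitMoment μ s n v with hh
  have hrn : ∀ n, r⁻¹ ^ n ≠ ∞ := fun n => ENNReal.pow_ne_top (ENNReal.inv_ne_top.2 hr0)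
  have hh0 : ∀ v, h v 0 = ‖WithLp.toLp 2 v‖ₑ ^ s := fun v => by simp [hh, orbitMoment_zero]
  have hhtop : ∀ v n, h v n ≠ ∞ := fun v n =>
    ENNReal.mul_ne_top (hrn n) (orbitMoment_ne_top hs hμ n v)
  have hcont : ∀ n, Continuous fun v => h v n := fun n =>
    (ENNReal.continuous_const_mul (hrn n)).comp (continuous_orbitMoment hs hμ n)
  set f : (Fin d → ℝ) → ℝ≥0∞ := fun v => ∑ n ∈ Finset.range N, h v n with hf
  have hfcont : Continuous f := continuous_finsetSum _ fun n _ => hcont n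
  have hstep : ∀ v, ∫⁻ A, f (A.mulVec v) ∂μ ≤ r * f v := by
    intro v
    -- Averaging shifts the sum by one index, up to the factor r. The new last term is at most the
    -- lost first one, so the shifted sum does not exceed `f v`.
    have hN' : h v N ≤ h v 0 := by
      rw [hh0]
      calc r⁻¹ ^ N * orbitMoment μ s N v
          ≤ r⁻¹ ^ N * (r ^ N * ‖WithLp.toLp 2 v‖ₑ ^ s) := by
            gcongr; exact (orbitMoment_le hs N v).trans (by gcongr)
        _ = _ := by
            rw [← mul_assoc, ← mul_pow, ENNReal.inv_mul_cancel hr0 hr, one_pow, one_mul]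
    have hint : ∫⁻ A, f (A.mulVec v) ∂μ = r * ∑ n ∈ Finset.range N, h v (n + 1) := by
      have hmeas : ∀ n, Measurable fun A : Matrix (Fin d) (Fin d) ℝ =>
          orbitMoment μ s n (A.mulVec v) := fun n =>
        ((continuous_orbitMoment hs hμ n).comp
          (continuous_id.matrix_mulVec continuous_const)).measurable
      simp only [hf, hh]
      rw [lintegral_finsetSum _ fun n _ => (hmeas n).const_mul _, Finset.mul_sum]
      refine Finset.sum_congr rfl fun n _ => ?_
      rw [lintegral_const_mul _ (hmeas n), lintegral_orbitMoment_mulVec, pow_succ']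
      simp only [← mul_assoc]
      rw [ENNReal.mul_inv_cancel hr0 hr, one_mul]
    rw [hint]
    gcongr
    have e1 := Finset.sum_range_succ (h v) N
    rw [Finset.sum_range_succ'] at e1
    refine (ENNReal.add_le_add_iff_right (hhtop v 0)).1 ?_
    rw [e1]
    gcongr
  obtain ⟨V, hV, hV1, hVw⟩ := exists_auerbach_basis hs f hfcont
    (fun c v => by
      simp only [hf, hh, Finset.mul_sum, orbitMoment_smul hs]
      exact Finset.sum_congr rfl fun n _ => by ring)
    (fun v => ENNReal.sum_ne_top.2 fun n _ => hhtop v n)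
    (fun v i => by
      -- The term n = 0, present since N ≥ 1, is ‖v‖^s and already dominates each coordinate.
      refine le_trans ?_ (Finset.single_le_sum (f := h v) (fun _ _ => zero_le)
        (Finset.mem_range.2 (Nat.pos_of_ne_zero hN)))
      rw [hh0]
      refine ENNReal.rpow_le_rpow ?_ hs.le
      rw [← ofReal_norm, ← ofReal_norm]
      exact ENNReal.ofReal_le_ofReal (PiLp.norm_apply_le (WithLp.toLp 2 v) i))
  refine ⟨V, hV, fun i j => ?_⟩
  calc ∫⁻ A, ‖(V⁻¹ * A * V) i j‖ₑ ^ s ∂μ ≤ ∫⁻ A, f (A.mulVec (V.col j)) ∂μ := by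
        refine lintegral_mono fun A => ?_
        have : (V⁻¹ * A * V) i j = (V⁻¹.mulVec (A.mulVec (V.col j))) i := by
          rw [Matrix.mul_assoc]; rfl
        rw [this]
        exact hVw _ i
    _ ≤ r * f (V.col j) := hstep _
    _ ≤ r * 1 := by gcongr; exact hV1 j
    _ = r := mul_one r

end OrbitMoment

/-! ### Fekete's lemma with values in [-∞, ∞). -/

/-- **Fekete's lemma** for submultiplicative sequences of extended nonnegative reals. -/
theorem exists_tendsto_log_div_of_submultiplicative {a : ℕ → ℝ≥0∞} (ha : ∀ n, a n ≠ ∞)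
    (hmul : ∀ m n, a (m + n) ≤ a m * a n) :
    ∃ L : EReal, Tendsto (fun n : ℕ => ENNReal.log (a n) / (n : EReal)) atTop (𝓝 L) ∧
      ∀ n : ℕ, n ≠ 0 → L ≤ ENNReal.log (a n) / (n : EReal) := by
  set u : ℕ → EReal := fun n => ENNReal.log (a n) / (n : EReal) with hu
  have hle : ∀ n : ℕ, n ≠ 0 → (⨅ n : {n : ℕ // n ≠ 0}, u n) ≤ u n := fun n hn =>
    iInf_le (fun n : {n : ℕ // n ≠ 0} => u n) ⟨n, hn⟩
  refine ⟨⨅ n : {n : ℕ // n ≠ 0}, u n, tendsto_order.2 ⟨fun c hc => ?_, fun c hc => ?_⟩, hle⟩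
  · filter_upwards [eventually_ne_atTop 0] with n hn
    exact hc.trans_le (hle n hn)
  -- One zero term makes all later terms zero; otherwise the logarithms are real and the classical
  -- lemma applies.
  · by_cases h0 : ∃ m, a m = 0
    · obtain ⟨m, hm⟩ := h0
      filter_upwards [eventually_ge_atTop m, eventually_ne_atTop 0] with n hn hn0
      have han : a n = 0 := by
        have := hmul m (n - m)
        rwa [hm, zero_mul, Nat.add_sub_cancel' hn, nonpos_iff_eq_zero] at this
      have : u n = ⊥ := by
        simp only [hu, han, ENNReal.log_zero]
        exact EReal.bot_div_of_pos_ne_top (by exact_mod_cast Nat.pos_of_ne_zero hn0)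
          (EReal.natCast_ne_top n)
      rw [this]
      exact bot_le.trans_lt hc
    · push Not at h0
      set w : ℕ → ℝ := fun n => Real.log (a n).toReal with hw
      have hpos : ∀ n, 0 < (a n).toReal := fun n => ENNReal.toReal_pos (h0 n) (ha n)
      have huw : ∀ n, u n = ((w n / n : ℝ) : EReal) := by
        intro n
        simp only [hu, hw]
        rw [EReal.coe_div, EReal.coe_natCast, ENNReal.log_pos_real (h0 n) (ha n)]
      have hsub : Subadditive w := by
        intro m n
        simp only [hw]
        rw [← Real.log_mul (hpos m).ne' (hpos n).ne', ← ENNReal.toReal_mul]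
        exact Real.log_le_log (hpos _)
          (ENNReal.toReal_mono (ENNReal.mul_ne_top (ha m) (ha n)) (hmul m n))
      obtain ⟨⟨n, hn⟩, hnc⟩ := iInf_lt_iff.1 hc
      obtain ⟨t, ht1, ht2⟩ := EReal.lt_iff_exists_real_btwn.1 hnc
      simp only [huw] at ht1
      filter_upwards [hsub.eventually_div_lt_of_div_lt hn (EReal.coe_lt_coe_iff.1 ht1)] with p hp
      rw [huw]
      exact (EReal.coe_lt_coe_iff.2 hp).trans ht2

/-! ### Integrating the pointwise inequality and tracking constants. -/

section Main

variable {d : ℕ} {μ : Measure (Matrix (Fin d) (Fin d) ℝ)} {s : ℝ}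

lemma ENNReal.rpow_sum_le_sum_rpow {ι : Type*} (t : Finset ι) (g : ι → ℝ≥0∞) {p : ℝ}
    (hp : 0 < p) (hp1 : p ≤ 1) : (∑ i ∈ t, g i) ^ p ≤ ∑ i ∈ t, g i ^ p :=
  Finset.le_sum_of_subadditive (fun x : ℝ≥0∞ => x ^ p) (ENNReal.zero_rpow_of_pos hp).le
    (fun x y => ENNReal.rpow_add_le_add_rpow x y hp.le hp1) t g

lemma ofReal_frobNorm_rpow (X : Matrix (Fin d) (Fin d) ℝ) (s : ℝ) :
    ENNReal.ofReal X.frobNorm ^ s = (∑ q : Fin d × Fin d, ‖X q.1 q.2‖ₑ ^ (2 : ℝ)) ^ (s / 2) := by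
  have h : ENNReal.ofReal X.frobNorm =
      (∑ q : Fin d × Fin d, ‖X q.1 q.2‖ₑ ^ (2 : ℝ)) ^ (2⁻¹ : ℝ) := by
    have h1 : ∀ q : Fin d × Fin d, ‖X q.1 q.2‖ₑ ^ (2 : ℝ) = ENNReal.ofReal (X q.1 q.2 ^ 2) := by
      intro q
      rw [← ofReal_norm, ENNReal.rpow_two, ← ENNReal.ofReal_pow (norm_nonneg _),
        Real.norm_eq_abs, sq_abs]
    rw [Finset.sum_congr rfl fun q _ => h1 q, ← ENNReal.ofReal_sum_of_nonneg fun q _ => sq_nonneg _,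
      ENNReal.ofReal_rpow_of_nonneg (Finset.sum_nonneg fun q _ => sq_nonneg _) (by norm_num),
      Fintype.sum_prod_type, Matrix.frobNorm, Real.sqrt_eq_rpow, one_div]
  rw [h, ← ENNReal.rpow_mul, inv_mul_eq_div]

/-- For s ≤ 2 the power s/2 is subadditive; for s ≥ 2 the power mean inequality over d² entries
costs (d²)^(s/2 - 1) = d^(s - 2). -/
lemma ofReal_frobNorm_rpow_le (hd : 1 ≤ d) (hs : 0 < s) (X : Matrix (Fin d) (Fin d) ℝ) :
    ENNReal.ofReal X.frobNorm ^ s ≤ ENNReal.ofReal (max ((d : ℝ) ^ (s - 2)) 1) *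
      ∑ q : Fin d × Fin d, ‖X q.1 q.2‖ₑ ^ s := by
  have hpow : ∀ q : Fin d × Fin d, (‖X q.1 q.2‖ₑ ^ (2 : ℝ)) ^ (s / 2) = ‖X q.1 q.2‖ₑ ^ s := by
    intro q
    rw [← ENNReal.rpow_mul, mul_div_cancel₀ s (two_ne_zero)]
  rw [ofReal_frobNorm_rpow]
  rcases le_total s 2 with h | h
  · refine (ENNReal.rpow_sum_le_sum_rpow _ _ (by linarith) (by linarith)).trans ?_
    rw [Finset.sum_congr rfl fun q _ => hpow q]
    refine le_mul_of_one_le_left zero_le ?_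
    rw [ENNReal.one_le_ofReal]
    exact le_max_right _ _
  · refine (ENNReal.rpow_sum_le_const_mul_sum_rpow _ _ (by linarith)).trans ?_
    rw [Finset.sum_congr rfl fun q _ => hpow q]
    gcongr
    have hd0 : (0 : ℝ) < d := by exact_mod_cast hd
    have : ((Finset.univ : Finset (Fin d × Fin d)).card : ℝ≥0∞) = ENNReal.ofReal ((d : ℝ) ^ 2) := by
      rw [ENNReal.ofReal_pow hd0.le, ENNReal.ofReal_natCast]
      simp [sq]
    rw [this, ENNReal.ofReal_rpow_of_pos (by positivity), ← Real.rpow_natCast, ← Real.rpow_mul hd0.le]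
    refine ENNReal.ofReal_le_ofReal (le_max_of_le_left (le_of_eq ?_))
    congr 1
    push_cast
    ring

lemma Matrix.continuous_frobNorm :
    Continuous (Matrix.frobNorm : Matrix (Fin d) (Fin d) ℝ → ℝ) :=
  Real.continuous_sqrt.comp (continuous_finsetSum _ fun i _ => continuous_finsetSum _ fun j _ =>
    (continuous_id.matrix_elem i j).pow 2)

lemma measurable_conj_entry (V W : Matrix (Fin d) (Fin d) ℝ) (i j : Fin d) :
    Measurable fun A : Matrix (Fin d) (Fin d) ℝ => ‖(W * A * V) i j‖ₑ ^ s :=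
  (continuous_enorm.comp (((continuous_const.matrix_mul continuous_id).matrix_mul
    continuous_const).matrix_elem i j)).measurable.pow_const s

lemma measurable_frobNorm_conj (V W : Matrix (Fin d) (Fin d) ℝ) :
    Measurable fun A : Matrix (Fin d) (Fin d) ℝ => ENNReal.ofReal (W * A * V).frobNorm ^ s :=
  (ENNReal.continuous_ofReal.comp (Matrix.continuous_frobNorm.comp
    ((continuous_const.matrix_mul continuous_id).matrix_mul
      continuous_const))).measurable.pow_const s

/-- Integrated form of `exists_opNorm_matProd_le`. -/
lemma normMoment_le_of_basis [SFinite μ] (hd : 1 ≤ d) (hs : 0 < s)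
    {V : Matrix (Fin d) (Fin d) ℝ} (hV : IsUnit V.det) :
    normMoment μ s d ≤ d * (ENNReal.ofReal ((d : ℝ) ^ d) ^ s *
      ((∫⁻ A, ENNReal.ofReal (V⁻¹ * A * V).frobNorm ^ s ∂μ) *
        (∫⁻ A, matNorm A ^ s ∂μ) ^ (d - 1))) := by
  -- Slot k carries the conjugated Frobenius norm. As the good position k depends on A, it is
  -- replaced by a sum over all k, whence the leading factor d.
  set g : Fin d → Fin d → Matrix (Fin d) (Fin d) ℝ → ℝ≥0∞ := fun k m =>
    if m = k then fun X => ENNReal.ofReal (V⁻¹ * X * V).frobNorm ^ s else fun X => matNorm X ^ s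
    with hg
  have hgm : ∀ k m, Measurable (g k m) := by
    intro k m
    by_cases h : m = k
    · simp only [hg, h, if_true]; exact measurable_frobNorm_conj V V⁻¹
    · simp only [hg, h, if_false]; exact measurable_matNorm_rpow s
  have hpt : ∀ A : Fin d → Matrix (Fin d) (Fin d) ℝ, matNorm (matProd A) ^ s ≤
      ∑ k, ENNReal.ofReal ((d : ℝ) ^ d) ^ s * ∏ m, g k m (A m) := by
    intro A
    obtain ⟨k, hk⟩ := exists_opNorm_matProd_le hd hV A
    refine le_trans ?_ (Finset.single_le_sum (fun _ _ => zero_le) (Finset.mem_univ k))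
    rw [← Finset.mul_prod_erase Finset.univ (fun m => g k m (A m)) (Finset.mem_univ k)]
    have h1 : ∏ m ∈ Finset.univ.erase k, g k m (A m) =
        (ENNReal.ofReal (∏ m ∈ Finset.univ.erase k, (A m).opNorm)) ^ s := by
      rw [ENNReal.ofReal_prod_of_nonneg fun m _ => (A m).opNorm_nonneg,
        ← ENNReal.prod_rpow_of_nonneg hs.le]
      refine Finset.prod_congr rfl fun m hm => ?_
      simp only [hg, Finset.ne_of_mem_erase hm, if_false, matNorm_eq]
    have h2 : g k k (A k) = ENNReal.ofReal (V⁻¹ * A k * V).frobNorm ^ s := by simp [hg]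
    rw [h1, h2, ← ENNReal.mul_rpow_of_nonneg _ _ hs.le, ← ENNReal.mul_rpow_of_nonneg _ _ hs.le,
      ← ENNReal.ofReal_mul (Matrix.frobNorm_nonneg _), ← ENNReal.ofReal_mul (by positivity),
      matNorm_eq]
    exact ENNReal.rpow_le_rpow (ENNReal.ofReal_le_ofReal hk) hs.le
  have hprodm : ∀ k, Measurable fun A : Fin d → Matrix (Fin d) (Fin d) ℝ => ∏ m, g k m (A m) :=
    fun k => Finset.measurable_prod _ fun m _ => (hgm k m).comp (measurable_pi_apply m)
  rw [normMoment, prodMeasure, lintegral_map (measurable_matNorm_rpow s) (measurable_matProd d)]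
  refine (lintegral_mono hpt).trans ?_
  rw [lintegral_finsetSum _ fun k _ => (hprodm k).const_mul _]
  refine le_of_eq ?_
  have hk : ∀ k : Fin d, ∫⁻ A, ENNReal.ofReal ((d : ℝ) ^ d) ^ s * ∏ m, g k m (A m)
      ∂(powMeasure μ d) = ENNReal.ofReal ((d : ℝ) ^ d) ^ s *
      ((∫⁻ A, ENNReal.ofReal (V⁻¹ * A * V).frobNorm ^ s ∂μ) *
        (∫⁻ A, matNorm A ^ s ∂μ) ^ (d - 1)) := by
    intro k
    rw [lintegral_const_mul _ (hprodm k), lintegral_powMeasure_prod μ (g k) (hgm k),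
      ← Finset.mul_prod_erase Finset.univ _ (Finset.mem_univ k)]
    congr 2
    · simp [hg]
    · rw [Finset.prod_congr rfl (g := fun _ => ∫⁻ A, matNorm A ^ s ∂μ), Finset.prod_const,
        Finset.card_erase_of_mem (Finset.mem_univ k), Finset.card_univ, Fintype.card_fin]
      intro m hm
      simp only [hg, Finset.ne_of_mem_erase hm, if_false]
  rw [Finset.sum_congr rfl fun k _ => hk k, Finset.sum_const, Finset.card_univ, Fintype.card_fin,
    nsmul_eq_mul]

/-- In d³, one factor is for the position k and two are for the d² entries. If the maximum on the
left is 1, the left side equals the d^(1 - s) branch of the constant; otherwise it is d^(1 + (d +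
1)s), below the other branch. -/
lemma le_bochiConst (hd : 1 ≤ d) (s : ℝ) :
    (d : ℝ) ^ (d * s) * ((d : ℝ) ^ 3 * max ((d : ℝ) ^ (s - 2)) 1) ≤ bochiConst d s := by
  have hd1 : (1 : ℝ) ≤ d := by exact_mod_cast hd
  have hd0 : (0 : ℝ) < d := by linarith
  rw [bochiConst, ← Real.rpow_natCast (d : ℝ) 3]
  rcases le_total ((d : ℝ) ^ (s - 2)) 1 with h | h
  · rw [max_eq_right h, mul_one, ← Real.rpow_add hd0]
    refine le_trans (le_of_eq ?_) (mul_le_mul_of_nonneg_left (le_max_left _ _) (by positivity))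
    rw [← Real.rpow_add hd0]
    congr 1
    push_cast
    ring
  · rw [max_eq_left h, ← Real.rpow_add hd0, ← Real.rpow_add hd0]
    refine le_trans ?_ (mul_le_mul_of_nonneg_left (le_max_right _ _) (by positivity))
    rw [mul_one]
    refine Real.rpow_le_rpow_of_exponent_le hd1 ?_
    push_cast
    linarith

lemma normMoment_le_bochiConst_mul [SFinite μ] (hd : 1 ≤ d) (hs : 0 < s)
    (hμ : ∫⁻ A, matNorm A ^ s ∂μ < ∞) {r : ℝ≥0∞} (hr0 : r ≠ 0) (hr : r ≠ ∞) {N : ℕ} (hN : N ≠ 0)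
    (hNr : normMoment μ s N ≤ r ^ N) :
    normMoment μ s d ≤ ENNReal.ofReal (bochiConst d s) * r *
      (∫⁻ A, matNorm A ^ s ∂μ) ^ (d - 1) := by
  obtain ⟨V, hV, hVr⟩ := exists_basis_lintegral_entry_le hs hμ hr0 hr hN hNr
  have hd0 : (0 : ℝ) < d := by exact_mod_cast hd
  set c := max ((d : ℝ) ^ (s - 2)) 1 with hc
  have hfrob : ∫⁻ A, ENNReal.ofReal (V⁻¹ * A * V).frobNorm ^ s ∂μ ≤
      ENNReal.ofReal c * (ENNReal.ofReal ((d : ℝ) ^ 2) * r) := by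
    refine (lintegral_mono fun A => ofReal_frobNorm_rpow_le hd hs _).trans ?_
    rw [lintegral_const_mul _ (Finset.measurable_sum _ fun q _ => measurable_conj_entry V V⁻¹ _ _),
      lintegral_finsetSum _ fun q _ => measurable_conj_entry V V⁻¹ _ _]
    gcongr
    refine (Finset.sum_le_sum fun q _ => hVr q.1 q.2).trans (le_of_eq ?_)
    rw [ENNReal.ofReal_pow hd0.le, ENNReal.ofReal_natCast]
    simp [sq]
  refine (normMoment_le_of_basis hd hs hV).trans ?_
  have hdd : ENNReal.ofReal ((d : ℝ) ^ d) ^ s = ENNReal.ofReal ((d : ℝ) ^ (d * s)) := by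
    rw [ENNReal.ofReal_rpow_of_pos (by positivity), ← Real.rpow_natCast, ← Real.rpow_mul hd0.le]
  have hc0 : 0 ≤ c := le_trans zero_le_one (le_max_right _ _)
  calc _ ≤ (d : ℝ≥0∞) * (ENNReal.ofReal ((d : ℝ) ^ d) ^ s *
        ((ENNReal.ofReal c * (ENNReal.ofReal ((d : ℝ) ^ 2) * r)) *
          (∫⁻ A, matNorm A ^ s ∂μ) ^ (d - 1))) := by gcongr
    _ = ENNReal.ofReal ((d : ℝ) ^ (d * s) * ((d : ℝ) ^ 3 * c)) * r *
          (∫⁻ A, matNorm A ^ s ∂μ) ^ (d - 1) := by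
        rw [hdd, ENNReal.ofReal_mul (by positivity), ENNReal.ofReal_mul (by positivity),
          pow_succ (d : ℝ) 2, ENNReal.ofReal_mul (by positivity), ENNReal.ofReal_natCast]
        ring
    _ ≤ _ := by
        gcongr
        exact le_bochiConst hd s

end Main

/-! ### The limit, the inequality and the degenerate case. -/

theorem mainTheorem1 (d : ℕ) (hd : 1 ≤ d)
    (μ : Measure (Matrix (Fin d) (Fin d) ℝ)) (s : ℝ) (hs : 0 < s)
    (hμ : ∫⁻ A, matNorm A ^ s ∂μ < ∞) :
    Tendsto (pressureSeq μ s) atTop (𝓝 (normPressure μ s)) ∧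
    normPressure μ s < ⊤ ∧
    ∫⁻ A, matNorm A ^ s ∂(prodMeasure μ d) ≤
      ENNReal.ofReal (bochiConst d s) * EReal.exp (normPressure μ s) *
        (∫⁻ A, matNorm A ^ s ∂μ) ^ (d - 1) ∧
    (normPressure μ s = ⊥ ↔ ∫⁻ A, matNorm A ^ s ∂(prodMeasure μ d) = 0) := by
  have := sFinite_of_lintegral_matNorm_rpow hs hμ
  obtain ⟨L, hL, hLle⟩ := exists_tendsto_log_div_of_submultiplicative
    (fun n => (normMoment_lt_top hs hμ n).ne) (normMoment_add_le hs)
  rw [← funext fun n => pressureSeq_eq (μ := μ) (s := s) n] at hL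
  have hlim : normPressure μ s = L := hL.limUnder_eq
  rw [hlim]
  change _ ∧ _ ∧ normMoment μ s d ≤ _ ∧ (_ ↔ normMoment μ s d = 0)
  have hLtop : L < ⊤ := by
    refine (hLle 1 one_ne_zero).trans_lt ?_
    simpa using normMoment_lt_top hs hμ 1
  have hexp : EReal.exp L < ∞ := by
    rwa [← ENNReal.log_lt_log_iff, EReal.log_exp, ENNReal.log_top]
  have hineq : normMoment μ s d ≤ ENNReal.ofReal (bochiConst d s) * EReal.exp L *
      (∫⁻ A, matNorm A ^ s ∂μ) ^ (d - 1) := by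
    set C := ENNReal.ofReal (bochiConst d s) * (∫⁻ A, matNorm A ^ s ∂μ) ^ (d - 1) with hC
    have hCtop : C ≠ ∞ := ENNReal.mul_ne_top ENNReal.ofReal_ne_top (ENNReal.pow_ne_top hμ.ne)
    -- Working with r above exp L keeps r positive even when L = ⊥.
    have key : ∀ r, EReal.exp L < r → r ≠ ∞ → normMoment μ s d ≤ C * r := by
      intro r hr hrtop
      have hLr : L < ENNReal.log r := by
        rwa [← EReal.log_exp L, ENNReal.log_lt_log_iff]
      obtain ⟨N, hN, hN0⟩ :=
        ((hL.eventually_lt_const hLr).and (eventually_ne_atTop 0)).exists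
      have hNr : normMoment μ s N ≤ r ^ N := by
        rw [pressureSeq_eq] at hN
        rw [← ENNReal.log_le_log_iff, ENNReal.log_pow]
        exact (EReal.div_le_iff_le_mul (by exact_mod_cast Nat.pos_of_ne_zero hN0)
          (EReal.natCast_ne_top N)).1 hN.le
      refine (normMoment_le_bochiConst_mul hd hs hμ (zero_le.trans_lt hr).ne' hrtop hN0
        hNr).trans (le_of_eq ?_)
      rw [hC]; ring
    have : normMoment μ s d ≤ C * EReal.exp L := by
      -- C vanishes when d ≥ 2 and the first moment is zero, so dividing by it needs a separate
      -- case.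
      by_cases hC0 : C = 0
      · obtain ⟨r, hr1, hr2⟩ := exists_between hexp
        simpa [hC0] using key r hr1 hr2.ne
      · rw [mul_comm, ← ENNReal.div_le_iff hC0 hCtop]
        refine le_of_forall_gt_imp_ge_of_dense fun r hr => ?_
        rcases eq_or_ne r ∞ with rfl | h
        · exact le_top
        · rw [ENNReal.div_le_iff hC0 hCtop, mul_comm]
          exact key r hr h
    refine this.trans (le_of_eq ?_)
    rw [hC]; ring
  refine ⟨hL, hLtop, hineq, fun h => ?_, fun h => ?_⟩
  · simpa [h] using hineq
  -- L bounds every term of the sequence from below, so one vanishing moment forces L = ⊥.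
  · have hle := hLle d (by omega)
    rw [h, ENNReal.log_zero, EReal.bot_div_of_pos_ne_top (by exact_mod_cast hd)
      (EReal.natCast_ne_top d)] at hle
    exact le_bot_iff.1 hle
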